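/- Let $\beta>1$ be a real number and let $T_\beta x=\beta x-\lfloor \beta x\rfloor$ be the $\beta$-transformation. Let $\phi:\{1,2,3,\dots\}\to(0,\infty)$ be nondecreasing with $\phi(n)\to\infty$ as $n\to\infty$, and put $\eta:=\liminf_{n\to\infty}\phi(n)/n\in[0,\infty]$. Then \[ \dim_{\rm H}\left\{x\in[0,1):\ \liminf_{n\to\infty}\frac{\log T_\beta^n x}{\phi(n)}=-1\right\}=\frac{1}{1+\eta/\log\beta}, \] where $\dim_{\rm H}$ denotes Hausdorff dimension, $\log 0:=-\infty$, the lower limits are taken in the extended real line, and $1/\infty:=0$ (so the dimension is $0$ when $\eta=\infty$). -/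

import Mathlib

open Filter MeasureTheory
open scoped ENNReal

/-- The `β`-transformation `T_β x = β x - ⌊β x⌋`. -/
noncomputable def betaT (β x : ℝ) : ℝ := β * x - ⌊β * x⌋

/-- The extended logarithm of a nonnegative real number, with `log 0 = -∞`. -/
noncomputable def extLog (x : ℝ) : EReal := ENNReal.log (ENNReal.ofReal x)

/-- The set of `x ∈ [0,1)` with `liminf_{n → ∞} log (T_β^n x) / φ(n) = -1`
(the lower limit is taken in the extended real line). -/
noncomputable def orbitLevelSet (β : ℝ) (φ : ℕ → ℝ) : Set ℝ :=
  {x ∈ Set.Ico (0 : ℝ) 1 |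
    liminf (fun n : ℕ => extLog ((betaT β)^[n] x) / (φ n : EReal)) atTop = -1}

/-- `η = liminf_{n → ∞} φ(n) / n`, as an element of `[0, ∞]`, for `φ` positive on `n ≥ 1`. -/
noncomputable def lowerSlope (φ : ℕ → ℝ) : ℝ≥0∞ :=
  liminf (fun n : ℕ => ENNReal.ofReal (φ n / n)) atTop

/-! Upper bound. The distance from x to the left end of its cylinder of order n is T^n x / β^n
(`sub_mem_cylinderEndpoints`). If a < η, points of the level set satisfy T^n x < e^(-an) infinitely
often, so they lie in infinitely many intervals of length (e^(-a)/β)^n attached to left endpoints.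
There are at most (1+2n)β^n of these for each n, and the resulting limsup cover gives dimension at
most log β / (a + log β); then a tends to η (`dimH_frequently_lt_exp_le`).

Lower bound. Full cylinders concatenate freely, and for some length m there are at least β^(θm) of
them, with θ < 1 as close to 1 as desired (`exists_many_fullEndpoints`). Points are built from free
blocks, which code the base-M digits of y in [0,1), and special blocks 1 0⋯0 of length about
φ(t+1)/log β starting at position t, which make T^(t+1) x as small as e^(-φ(t+1)). Special blocks
are placed only where φ(t) is about at most ηt and where free blocks already fill a proportion θ of
the prefix, so free blocks always fill a proportion of about θ/(1+η/log β) (`exists_schedule`). The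
coding y ↦ x therefore has an inverse that is Hölder with exponent near 1/(1+η/log β)
(`exists_expanding_map`), and that exponent bounds the dimension from below
(`le_dimH_of_expanding`). -/

lemma betaT_nonneg (β x : ℝ) : 0 ≤ betaT β x := Int.fract_nonneg (β * x)

lemma betaT_lt_one (β x : ℝ) : betaT β x < 1 := Int.fract_lt_one (β * x)

lemma betaT_zero (β : ℝ) : betaT β 0 = 0 := by simp [betaT]

lemma betaT_eq_of_floor {β x : ℝ} {k : ℤ} (h₀ : (k : ℝ) ≤ β * x) (h₁ : β * x < k + 1) :
    betaT β x = β * x - k := by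
  have h : ⌊β * x⌋ = k := Int.floor_eq_iff.2 ⟨h₀, h₁⟩
  rw [betaT, h]

lemma betaT_eq_mul {β x : ℝ} (h₀ : 0 ≤ β * x) (h₁ : β * x < 1) : betaT β x = β * x := by
  rw [betaT_eq_of_floor (k := 0) (by simpa using h₀) (by simpa using h₁)]; simp

lemma betaT_le_mul {β x : ℝ} (h : 0 ≤ β * x) : betaT β x ≤ β * x := by
  have : (0 : ℝ) ≤ ⌊β * x⌋ := by exact_mod_cast Int.floor_nonneg.2 h
  rw [betaT]; linarith

lemma betaT_iterate_mem {β x : ℝ} (hx : x ∈ Set.Ico (0 : ℝ) 1) (n : ℕ) :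
    (betaT β)^[n] x ∈ Set.Ico (0 : ℝ) 1 := by
  cases n with
  | zero => exact hx
  | succ n =>
    rw [Function.iterate_succ_apply']
    exact ⟨betaT_nonneg _ _, betaT_lt_one _ _⟩

lemma betaT_iterate_le {β x : ℝ} (hβ : 0 ≤ β) (hx : x ∈ Set.Ico (0 : ℝ) 1) (n : ℕ) :
    (betaT β)^[n] x ≤ β ^ n * x := by
  induction n with
  | zero => simp
  | succ n ih =>
    rw [Function.iterate_succ_apply']
    calc _ ≤ β * (betaT β)^[n] x := betaT_le_mul (mul_nonneg hβ (betaT_iterate_mem hx n).1)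
      _ ≤ β * (β ^ n * x) := by gcongr
      _ = _ := by ring

lemma betaT_iterate_eq_mul {β x : ℝ} (hβ : 1 ≤ β) (hx : 0 ≤ x) (n : ℕ) (h : β ^ n * x < 1) :
    (betaT β)^[n] x = β ^ n * x := by
  induction n with
  | zero => simp
  | succ n ih =>
    have h' : β * (β ^ n * x) < 1 := by rw [pow_succ] at h; linarith
    have h0 : 0 ≤ β ^ n * x := by positivity
    rw [Function.iterate_succ_apply', ih (by nlinarith), betaT_eq_mul (by positivity) h']
    ring

/-- Moving a point to the left inside its cylinder of order `n`. -/
lemma betaT_iterate_sub {β x t : ℝ} (hβ : 0 < β) (hx : x ∈ Set.Ico (0 : ℝ) 1) (n : ℕ)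
    (ht : 0 ≤ t) (htx : t ≤ (betaT β)^[n] x) :
    (betaT β)^[n] (x - t / β ^ n) = (betaT β)^[n] x - t := by
  induction n generalizing t with
  | zero => simp
  | succ n ih =>
    have hy := betaT_iterate_mem (β := β) hx n
    have hle : (betaT β)^[n + 1] x ≤ β * (betaT β)^[n] x := by
      rw [Function.iterate_succ_apply']
      exact betaT_le_mul (mul_nonneg hβ.le hy.1)
    have h1 : t / β ≤ (betaT β)^[n] x := by
      rw [div_le_iff₀ hβ]; linarith
    have e : x - t / β ^ (n + 1) = x - t / β / β ^ n := by
      rw [div_div, pow_succ']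
    have hm : β * ((betaT β)^[n] x - t / β) = β * (betaT β)^[n] x - t := by field_simp
    have hlt := betaT_lt_one β ((betaT β)^[n] x)
    rw [Function.iterate_succ_apply'] at htx
    rw [e, Function.iterate_succ_apply', ih (by positivity) h1, Function.iterate_succ_apply',
      betaT_eq_of_floor (k := ⌊β * (betaT β)^[n] x⌋), hm]
    · rw [betaT]; ring
    · rw [hm]; rw [betaT] at htx; linarith
    · rw [hm]; rw [betaT] at hlt; linarith

/-! ### Cylinder endpoints: separation and counting -/

/-- Zeros in `[0,1)` of the `n`-th iterate: the left endpoints of the cylinders of order `n`. -/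
def cylinderEndpoints (β : ℝ) (n : ℕ) : Set ℝ :=
  {x ∈ Set.Ico (0 : ℝ) 1 | (betaT β)^[n] x = 0}

/-- Left endpoints of the cylinders of order `n + 1` that are not of order `n`. -/
def newEndpoints (β : ℝ) (n : ℕ) : Set ℝ :=
  {x ∈ Set.Ico (0 : ℝ) 1 | (betaT β)^[n] x ≠ 0 ∧ (betaT β)^[n + 1] x = 0}

lemma sub_mem_cylinderEndpoints {β x : ℝ} (hβ : 0 < β) (hx : x ∈ Set.Ico (0 : ℝ) 1) (n : ℕ) :
    x - (betaT β)^[n] x / β ^ n ∈ cylinderEndpoints β n := by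
  have hy := betaT_iterate_mem (β := β) hx n
  refine ⟨⟨?_, ?_⟩, ?_⟩
  · have := betaT_iterate_le hβ.le hx n
    rw [sub_nonneg, div_le_iff₀ (by positivity)]; linarith
  · have : 0 ≤ (betaT β)^[n] x / β ^ n := div_nonneg hy.1 (by positivity)
    linarith [hx.2]
  · rw [betaT_iterate_sub hβ hx n hy.1 le_rfl, sub_self]

lemma cylinderEndpoints_succ (β : ℝ) (n : ℕ) :
    cylinderEndpoints β (n + 1) = cylinderEndpoints β n ∪ newEndpoints β n := by
  ext x
  simp only [cylinderEndpoints, newEndpoints, Set.mem_ofPred_eq, Set.mem_union]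
  by_cases h : (betaT β)^[n] x = 0
  · simp [h, Function.iterate_succ_apply', betaT_zero]
  · simp [h]

/-- At a new endpoint β T^n q is a nonzero integer, hence at least 1. Its last digit can thus be
lowered by one, which produces the full cylinder to its left. -/
lemma newEndpoints_div_le {β q : ℝ} (hβ : 0 < β) {n : ℕ} (hq : q ∈ newEndpoints β n) :
    1 / β ≤ (betaT β)^[n] q := by
  obtain ⟨hq, h0, h1⟩ := hq
  have hy := betaT_iterate_mem (β := β) hq n
  rw [Function.iterate_succ_apply', betaT, sub_eq_zero] at h1
  have hpos : 0 < β * (betaT β)^[n] q := mul_pos hβ (lt_of_le_of_ne hy.1 (Ne.symm h0))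
  rw [h1] at hpos
  have : (1 : ℝ) ≤ ⌊β * (betaT β)^[n] q⌋ := by
    have h2 : (0 : ℤ) < ⌊β * (betaT β)^[n] q⌋ := by exact_mod_cast hpos
    exact_mod_cast (show (1 : ℤ) ≤ _ by omega)
  rw [div_le_iff₀ hβ]; linarith

/-- To the left of a new endpoint there is a full cylinder. -/
lemma betaT_iterate_sub_newEndpoints {β q t : ℝ} (hβ : 1 < β) {n : ℕ}
    (hq : q ∈ newEndpoints β n) (ht : 0 < t) (ht1 : t ≤ 1) :
    (betaT β)^[n + 1] (q - t / β ^ (n + 1)) = 1 - t := by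
  have hβ0 : 0 < β := by linarith
  have h := newEndpoints_div_le hβ0 hq
  obtain ⟨hq, h0, h1⟩ := hq
  have ht' : t / β ≤ (betaT β)^[n] q := le_trans (by gcongr) h
  have e : q - t / β ^ (n + 1) = q - t / β / β ^ n := by rw [div_div, pow_succ']
  have hm : β * ((betaT β)^[n] q - t / β) = β * (betaT β)^[n] q - t := by field_simp
  rw [Function.iterate_succ_apply', betaT, sub_eq_zero] at h1
  rw [e, Function.iterate_succ_apply', betaT_iterate_sub hβ0 hq n (by positivity) ht',
    betaT_eq_of_floor (k := ⌊β * (betaT β)^[n] q⌋ - 1), hm]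
  · push_cast; linarith
  · rw [hm]; push_cast; linarith
  · rw [hm]; push_cast; linarith

lemma div_pow_le_of_mem_newEndpoints {β q : ℝ} (hβ : 1 < β) {n : ℕ}
    (hq : q ∈ newEndpoints β n) : 1 / β ^ (n + 1) ≤ q := by
  have hβ0 : 0 < β := by linarith
  have h := newEndpoints_div_le hβ0 hq
  have h2 := betaT_iterate_le hβ0.le hq.1 n
  have h3 := h.trans h2
  rw [div_le_iff₀ hβ0] at h3
  rw [div_le_iff₀ (by positivity), pow_succ]
  linarith

lemma newEndpoints_separated {β q q' : ℝ} (hβ : 1 < β) {n : ℕ}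
    (hq : q ∈ newEndpoints β n) (hq' : q' ∈ newEndpoints β n) (h : q' < q) :
    q' + 1 / β ^ (n + 1) ≤ q := by
  by_contra! hlt
  have hβ0 : 0 < β ^ (n + 1) := by positivity
  have h1 := betaT_iterate_sub_newEndpoints (t := (q - q') * β ^ (n + 1)) hβ hq
    (mul_pos (by linarith) hβ0)
    (by rw [← le_div_iff₀ hβ0]; linarith)
  rw [mul_div_cancel_right₀ _ hβ0.ne', sub_sub_cancel, hq'.2.2] at h1
  have : (q - q') * β ^ (n + 1) < 1 := by rw [← lt_div_iff₀ hβ0]; linarith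
  linarith

lemma newEndpoints_finite {β : ℝ} (hβ : 1 < β) (n : ℕ) : (newEndpoints β n).Finite ∧
    ((newEndpoints β n).ncard : ℝ) ≤ β ^ (n + 1) + 1 := by
  have hβ0 : 0 < β ^ (n + 1) := by positivity
  set g : ℝ → ℕ := fun q => ⌊q * β ^ (n + 1)⌋₊
  have hmap : ∀ q ∈ newEndpoints β n, g q ∈ (Finset.range (⌊β ^ (n + 1)⌋₊ + 1) : Set ℕ) := by
    intro q hq
    simp only [Finset.coe_range, Set.mem_Iio, Nat.lt_succ_iff, g]
    apply Nat.floor_le_floor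
    nlinarith [hq.1.2]
  have hlt : ∀ q ∈ newEndpoints β n, ∀ q' ∈ newEndpoints β n, q' < q → g q ≠ g q' := by
    intro q hq q' hq' h
    have h1 := newEndpoints_separated hβ hq hq' h
    have h2 : q' * β ^ (n + 1) + 1 ≤ q * β ^ (n + 1) := by
      have := mul_le_mul_of_nonneg_right h1 hβ0.le
      rwa [add_mul, div_mul_cancel₀ _ hβ0.ne'] at this
    have h3 := Nat.floor_le_floor h2
    rw [Nat.floor_add_one (mul_nonneg hq'.1.1 hβ0.le)] at h3
    simp only [g]
    omega
  have hinj : Set.InjOn g (newEndpoints β n) := by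
    intro q hq q' hq' h
    rcases lt_trichotomy q q' with h1 | h1 | h1
    · exact absurd h.symm (hlt q' hq' q hq h1)
    · exact h1
    · exact absurd h (hlt q hq q' hq' h1)
  refine ⟨Set.Finite.of_injOn hmap hinj (Finset.finite_toSet _), ?_⟩
  have h1 := Set.ncard_le_ncard_of_injOn g hmap hinj (Finset.finite_toSet _)
  rw [Set.ncard_coe_finset, Finset.card_range] at h1
  calc ((newEndpoints β n).ncard : ℝ) ≤ ((⌊β ^ (n + 1)⌋₊ + 1 : ℕ) : ℝ) := by exact_mod_cast h1
    _ ≤ _ := by push_cast; gcongr; exact Nat.floor_le hβ0.le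

lemma cylinderEndpoints_zero (β : ℝ) : cylinderEndpoints β 0 = {0} := by
  ext x; simp only [cylinderEndpoints, Set.mem_ofPred_eq, Set.mem_singleton_iff, Function.iterate_zero, id]
  constructor
  · exact fun h => h.2
  · rintro rfl; simp

lemma cylinderEndpoints_finite {β : ℝ} (hβ : 1 < β) (n : ℕ) : (cylinderEndpoints β n).Finite := by
  induction n with
  | zero => rw [cylinderEndpoints_zero]; exact Set.finite_singleton 0
  | succ n ih => rw [cylinderEndpoints_succ]; exact ih.union (newEndpoints_finite hβ n).1

lemma cylinderEndpoints_ncard_le_of {β : ℝ} {u : ℕ → ℝ} (hu : Monotone u)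
    (h : ∀ n, ((newEndpoints β n).ncard : ℝ) ≤ u (n + 1)) (n : ℕ) :
    ((cylinderEndpoints β n).ncard : ℝ) ≤ 1 + n * u n := by
  induction n with
  | zero => rw [cylinderEndpoints_zero]; simp
  | succ n ih =>
    rw [cylinderEndpoints_succ]
    have h1 : ((cylinderEndpoints β n ∪ newEndpoints β n).ncard : ℝ) ≤
        (cylinderEndpoints β n).ncard + (newEndpoints β n).ncard := by
      exact_mod_cast Set.ncard_union_le _ _
    have h2 : (n : ℝ) * u n ≤ n * u (n + 1) := by gcongr; exact hu n.le_succ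
    push_cast
    linarith [h n]

lemma cylinderEndpoints_ncard_le {β : ℝ} (hβ : 1 < β) (n : ℕ) :
    ((cylinderEndpoints β n).ncard : ℝ) ≤ (1 + 2 * n) * β ^ n := by
  have h := cylinderEndpoints_ncard_le_of (u := fun n => β ^ n + 1) (β := β)
    (fun a b hab => by simpa using pow_le_pow_right₀ hβ.le hab)
    (fun n => (newEndpoints_finite hβ n).2) n
  have h1 : 1 ≤ β ^ n := one_le_pow₀ hβ.le
  have h2 : (n : ℝ) * 1 ≤ n * β ^ n := by gcongr
  linarith

/-- Cylinders of order n have length at most β^(-n), so the grid points k/β^n in [0,1) lie in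
distinct cylinders. -/
lemma pow_le_cylinderEndpoints_ncard {β : ℝ} (hβ : 1 < β) (n : ℕ) :
    β ^ n ≤ (cylinderEndpoints β n).ncard := by
  have hβ0 : 0 < β ^ n := by positivity
  set x : ℕ → ℝ := fun k => k / β ^ n
  have hx : ∀ k ∈ Finset.range ⌈β ^ n⌉₊, x k ∈ Set.Ico (0 : ℝ) 1 := by
    intro k hk
    refine ⟨by positivity, ?_⟩
    rw [div_lt_one hβ0]
    exact Nat.lt_ceil.1 (Finset.mem_range.1 hk)
  set g : ℕ → ℝ := fun k => x k - (betaT β)^[n] (x k) / β ^ n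
  have hlt : ∀ k ∈ Finset.range ⌈β ^ n⌉₊, ∀ l ∈ Finset.range ⌈β ^ n⌉₊, k < l → g k < g l := by
    intro k hk l hl h
    have h1 := betaT_iterate_mem (β := β) (hx k hk) n
    have h2 := betaT_iterate_mem (β := β) (hx l hl) n
    have h3 : (k : ℝ) + 1 ≤ l := by exact_mod_cast h
    simp only [g, x, ← sub_div] at *
    apply div_lt_div_of_pos_right _ hβ0
    linarith [h1.1, h2.2]
  have hinj : Set.InjOn g (Finset.range ⌈β ^ n⌉₊ : Set ℕ) := by
    intro k hk l hl h
    rcases lt_trichotomy k l with h1 | h1 | h1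
    · exact absurd h (hlt k hk l hl h1).ne
    · exact h1
    · exact absurd h (hlt l hl k hk h1).ne'
  have h1 := Set.ncard_le_ncard_of_injOn g
    (fun k hk => sub_mem_cylinderEndpoints (by linarith) (hx k hk) n) hinj
    (cylinderEndpoints_finite hβ n)
  rw [Set.ncard_coe_finset, Finset.card_range] at h1
  exact (Nat.le_ceil _).trans (by exact_mod_cast h1)

/-! ### Abundance of full cylinders -/

/-- `p` is the left endpoint of a full cylinder of order `m` whose closure lies in `(0,1)`. -/
structure IsFullEndpoint (β : ℝ) (m : ℕ) (p : ℝ) : Prop where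
  le : 1 / β ^ m ≤ p
  lt : p + 1 / β ^ m < 1
  iterate : ∀ t ∈ Set.Ico (0 : ℝ) 1, (betaT β)^[m] (p + t / β ^ m) = t

/-- The excluded q is the one whose left neighbour cylinder starts at 0. Any other starting point p
> 0 is a zero of the iterate, whereas T^m acts as multiplication by β^m on (0, β^(-m)); so p is at
least β^(-m). -/
lemma isFullEndpoint_sub {β q : ℝ} (hβ : 1 < β) {n : ℕ} (hq : q ∈ newEndpoints β n)
    (hne : q ≠ 1 / β ^ (n + 1)) : IsFullEndpoint β (n + 1) (q - 1 / β ^ (n + 1)) := by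
  have hβ0 : 0 < β ^ (n + 1) := by positivity
  have hit : ∀ t ∈ Set.Ico (0 : ℝ) 1,
      (betaT β)^[n + 1] (q - 1 / β ^ (n + 1) + t / β ^ (n + 1)) = t := by
    intro t ht
    have := betaT_iterate_sub_newEndpoints (t := 1 - t) hβ hq (by linarith [ht.2])
      (by linarith [ht.1])
    rw [sub_div, ← sub_add, sub_sub_cancel] at this
    exact this
  refine ⟨?_, by linarith [hq.1.2], hit⟩
  have h0 : 0 < q - 1 / β ^ (n + 1) :=
    sub_pos.2 (lt_of_le_of_ne (div_pow_le_of_mem_newEndpoints hβ hq) hne.symm)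
  have h1 := hit 0 (by simp)
  rw [zero_div, add_zero] at h1
  by_contra! h
  rw [betaT_iterate_eq_mul hβ.le h0.le] at h1
  · have := mul_pos hβ0 h0
    linarith
  · rw [lt_div_iff₀ hβ0] at h; linarith

lemma IsFullEndpoint.separated {β p p' : ℝ} (hβ : 1 < β) {m : ℕ} (hp : IsFullEndpoint β m p)
    (hp' : IsFullEndpoint β m p') (h : p < p') : p + 1 / β ^ m ≤ p' := by
  by_contra! hlt
  have hβ0 : 0 < β ^ m := by positivity
  have h1 := hp.iterate ((p' - p) * β ^ m) ⟨mul_nonneg (by linarith) hβ0.le, by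
    rw [← lt_div_iff₀ hβ0]; linarith⟩
  have h2 := hp'.iterate 0 (by simp)
  rw [mul_div_cancel_right₀ _ hβ0.ne', add_sub_cancel] at h1
  rw [zero_div, add_zero, h1] at h2
  have := mul_pos (sub_pos.2 h) hβ0
  linarith

/-- Otherwise summing over orders would bound the number of cylinders of order n by a linear factor
times B^n, against the lower bound β^n. -/
lemma exists_pow_le_newEndpoints_ncard {β B : ℝ} (hB : 1 < B) (hBβ : B < β) :
    ∃ n, B ^ (n + 1) + 1 < (newEndpoints β n).ncard := by
  by_contra! h
  have hβ : 1 < β := hB.trans hBβ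
  have h1 : ∀ n : ℕ, β ^ n ≤ (1 + 2 * n) * B ^ n := by
    intro n
    have h2 := cylinderEndpoints_ncard_le_of (u := fun n => B ^ n + 1)
      (fun a b hab => by simpa using pow_le_pow_right₀ hB.le hab) h n
    have h3 := pow_le_cylinderEndpoints_ncard hβ n
    have h4 : 1 ≤ B ^ n := one_le_pow₀ hB.le
    have h5 : (n : ℝ) * 1 ≤ n * B ^ n := by gcongr
    linarith
  have hB0 : 0 < B := by linarith
  have hr : |B / β| < 1 := by rw [abs_of_pos (by positivity), div_lt_one (by linarith)]; exact hBβ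
  have t1 := tendsto_pow_const_mul_const_pow_of_abs_lt_one 1 hr
  have t2 := tendsto_pow_const_mul_const_pow_of_abs_lt_one 0 hr
  have t3 := (t2.add (t1.const_mul 2)).eventually (gt_mem_nhds (show (0 + 2 * 0 : ℝ) < 1 by norm_num))
  obtain ⟨n, hn⟩ := t3.exists
  have := h1 n
  rw [pow_zero, pow_one, one_mul, div_pow] at hn
  have hβn : 0 < β ^ n := by positivity
  have e : B ^ n / β ^ n + 2 * (n * (B ^ n / β ^ n)) = (1 + 2 * n) * B ^ n / β ^ n := by ring
  rw [e, div_lt_one hβn] at hn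
  linarith

/-- The full cylinders of a suitable order are so many that they carry almost all the entropy. -/
lemma exists_many_fullEndpoints {β B : ℝ} (hB : 1 < B) (hBβ : B < β) :
    ∃ (m M : ℕ) (e : Fin M → ℝ), 1 ≤ m ∧ B ^ m ≤ M ∧ Function.Injective e ∧
      ∀ i, IsFullEndpoint β m (e i) := by
  have hβ : 1 < β := hB.trans hBβ
  obtain ⟨n, hn⟩ := exists_pow_le_newEndpoints_ncard hB hBβ
  have hfin := (newEndpoints_finite hβ n).1
  set S := hfin.toFinset.erase (1 / β ^ (n + 1))
  refine ⟨n + 1, S.card, fun i => (S.equivFin.symm i : ℝ) - 1 / β ^ (n + 1), by omega, ?_, ?_, ?_⟩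
  · have h1 : hfin.toFinset.card - 1 ≤ S.card := Finset.pred_card_le_card_erase
    rw [← Set.ncard_eq_toFinset_card _ hfin] at h1
    have h2 : ((newEndpoints β n).ncard : ℝ) ≤ S.card + 1 := by exact_mod_cast (by omega)
    linarith
  · intro i j h
    simpa using h
  · intro i
    have h := (S.equivFin.symm i).2
    simp only [S, Finset.mem_erase, Set.Finite.mem_toFinset] at h
    exact isFullEndpoint_sub hβ h.2 h.1

/-! ### Upper bound for the dimension -/

/-- For a < c < η, log T^n x < -(a/c) φ(n) infinitely often because -1 < -a/c, while φ(n) > cn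
eventually. -/
lemma frequently_lt_exp_of_mem_orbitLevelSet {β a x : ℝ} {φ : ℕ → ℝ} (ha : 0 ≤ a)
    (haη : ENNReal.ofReal a < lowerSlope φ) (hx : x ∈ orbitLevelSet β φ) :
    ∃ᶠ n : ℕ in atTop, (betaT β)^[n] x < Real.exp (-a) ^ n := by
  obtain ⟨c, hac, hcη⟩ := ENNReal.lt_iff_exists_nnreal_btwn.1 haη
  have hac' : a < c := by
    rw [← ENNReal.ofReal_coe_nnreal] at hac
    exact (ENNReal.ofReal_lt_ofReal_iff_of_nonneg ha).1 hac
  have hc : (0 : ℝ) < c := by linarith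
  have h1 : liminf (fun n : ℕ => extLog ((betaT β)^[n] x) / (φ n : EReal)) atTop <
      ((-(a / c) : ℝ) : EReal) := by
    rw [hx.2]
    have : (-1 : ℝ) < -(a / c) := neg_lt_neg ((div_lt_one hc).2 hac')
    exact EReal.coe_lt_coe_iff.2 this
  have h2 := frequently_lt_of_liminf_lt (by isBoundedDefault) h1
  have h3 := eventually_lt_of_lt_liminf hcη
  refine (h2.and_eventually (h3.and (eventually_ge_atTop 1))).mono ?_
  rintro n ⟨hn, hφ, hn1⟩
  have hn0 : (0 : ℝ) < n := by exact_mod_cast hn1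
  rw [← ENNReal.ofReal_coe_nnreal, ENNReal.ofReal_lt_ofReal_iff_of_nonneg hc.le,
    lt_div_iff₀ hn0] at hφ
  have hφ0 : 0 < φ n := lt_trans (by positivity) hφ
  rw [EReal.div_lt_iff (by exact_mod_cast hφ0) (EReal.coe_ne_top _), ← EReal.coe_mul] at hn
  by_cases hy : (betaT β)^[n] x ≤ 0
  · exact lt_of_le_of_lt hy (by positivity)
  push Not at hy
  rw [extLog, ENNReal.log_ofReal_of_pos hy, EReal.coe_lt_coe_iff] at hn
  rw [← Real.exp_nat_mul, ← Real.log_lt_iff_lt_exp hy]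
  have : a / c * (c * n) ≤ a / c * φ n := by gcongr
  have e : a / c * (c * n) = a * n := by field_simp
  linarith

lemma dimH_frequently_lt_exp_le {β a : ℝ} (hβ : 1 < β) (ha : 0 ≤ a) {s : NNReal}
    (hs : Real.log β < s * (a + Real.log β)) :
    dimH {x ∈ Set.Ico (0 : ℝ) 1 | ∃ᶠ n : ℕ in atTop, (betaT β)^[n] x < Real.exp (-a) ^ n} ≤ s := by
  have hβ0 : 0 < β := by linarith
  set c := Real.exp (-a) / β with hc
  have hc0 : 0 < c := by positivity
  have hcβ : c ≤ 1 / β := by rw [hc]; gcongr; simpa using ha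
  have hc1 : c < 1 := hcβ.trans_lt (by rw [div_lt_one hβ0]; exact hβ)
  set κ := β * c ^ (s : ℝ) with hκ
  have hκ0 : 0 < κ := by positivity
  -- This is exactly the hypothesis on s after taking logarithms.
  have hκ1 : κ < 1 := by
    rw [← Real.log_neg_iff hκ0, hκ, Real.log_mul hβ0.ne' (by positivity), Real.log_rpow hc0, hc,
      Real.log_div (by positivity) hβ0.ne', Real.log_exp]
    linarith
  set g : ℕ → ℝ := fun n => (1 + 2 * n) * κ ^ n with hg
  have hg0 : ∀ n, 0 ≤ g n := fun n => by positivity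
  have hsum : Summable g := by
    have t1 := summable_pow_mul_geometric_of_norm_lt_one 1
      (show ‖κ‖ < 1 by rwa [Real.norm_of_nonneg hκ0.le])
    have t0 := summable_geometric_of_lt_one hκ0.le hκ1
    refine (t0.add (t1.mul_left 2)).congr fun n => ?_
    simp only [hg]; ring
  have hfin : ∀ n, Finite (cylinderEndpoints β n) := fun n => cylinderEndpoints_finite hβ n
  apply dimH_le_of_hausdorffMeasure_ne_top
  refine ne_top_of_le_ne_top (b := ∑' n, ENNReal.ofReal (g n)) ?_ ?_
  · rw [← ENNReal.ofReal_tsum_of_nonneg hg0 hsum]; exact ENNReal.ofReal_ne_top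
  -- The N-th cover uses the cylinders of order at least N. Its cost is at most the whole sum of g,
  -- which is enough for a finite measure.
  refine (Measure.hausdorffMeasure_le_liminf_tsum (ι := fun N : ℕ => Σ k : ℕ,
    cylinderEndpoints β (N + k)) (s : ℝ) _ (l := atTop) (fun N => ENNReal.ofReal (c ^ N)) ?_
    (fun N i => Set.Icc (i.2 : ℝ) (i.2 + c ^ (N + i.1))) ?_ ?_).trans ?_
  · have := ENNReal.tendsto_ofReal (tendsto_pow_atTop_nhds_zero_of_lt_one hc0.le hc1)
    simpa using this
  · refine Eventually.of_forall fun N i => ?_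
    rw [Real.ediam_Icc, add_sub_cancel_left]
    exact ENNReal.ofReal_le_ofReal (pow_le_pow_of_le_one hc0.le hc1.le (by omega))
  · refine Eventually.of_forall fun N x hx => ?_
    obtain ⟨n, hn, hxn⟩ := frequently_atTop.1 hx.2 N
    obtain ⟨k, rfl⟩ := Nat.exists_eq_add_of_le hn
    refine Set.mem_iUnion.2 ⟨⟨k, _, sub_mem_cylinderEndpoints hβ0 hx.1 (N + k)⟩, ?_, ?_⟩
    · have := div_nonneg (betaT_iterate_mem (β := β) hx.1 (N + k)).1 (pow_pos hβ0 (N + k)).le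
      simpa using this
    · have : (betaT β)^[N + k] x / β ^ (N + k) ≤ c ^ (N + k) := by
        rw [hc, div_pow]; gcongr
      simp only
      linarith
  · refine liminf_le_of_frequently_le' (Eventually.frequently (Eventually.of_forall fun N => ?_))
    rw [ENNReal.tsum_sigma']
    refine le_trans (ENNReal.tsum_le_tsum fun k => ?_)
      (ENNReal.tsum_comp_le_tsum_of_injective (add_right_injective N) fun n => ENNReal.ofReal (g n))
    simp only [Real.ediam_Icc, add_sub_cancel_left]
    rw [ENNReal.tsum_const, ENat.card_eq_coe_natCard, Nat.card_coe_set_eq,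
      ENNReal.ofReal_rpow_of_nonneg (by positivity) s.coe_nonneg]
    simp only [ENat.toENNReal_coe]
    rw [← ENNReal.ofReal_natCast, ← ENNReal.ofReal_mul (by positivity)]
    apply ENNReal.ofReal_le_ofReal
    have e : (c ^ (N + k)) ^ (s : ℝ) = (c ^ (s : ℝ)) ^ (N + k) := by
      rw [← Real.rpow_natCast, ← Real.rpow_natCast, ← Real.rpow_mul hc0.le, ← Real.rpow_mul hc0.le,
        mul_comm]
    calc _ ≤ (1 + 2 * (N + k : ℕ)) * β ^ (N + k) * (c ^ (N + k)) ^ (s : ℝ) := by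
          gcongr; exact cylinderEndpoints_ncard_le hβ _
      _ = g (N + k) := by simp only [hg, hκ, e, mul_pow]; ring

lemma one_div_one_add_div_ofReal {L : ℝ} (hL : 0 < L) (η : NNReal) :
    1 / (1 + (η : ℝ≥0∞) / ENNReal.ofReal L) = ENNReal.ofReal (L / (L + η)) := by
  have e : L / (L + η) = 1 / (1 + η / L) := by field_simp
  rw [e, ENNReal.ofReal_div_of_pos (by positivity), ENNReal.ofReal_add zero_le_one (by positivity),
    ENNReal.ofReal_div_of_pos hL, ENNReal.ofReal_one, ENNReal.ofReal_coe_nnreal]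

lemma dimH_orbitLevelSet_le {β : ℝ} (hβ : 1 < β) (φ : ℕ → ℝ) :
    dimH (orbitLevelSet β φ) ≤ 1 / (1 + lowerSlope φ / ENNReal.ofReal (Real.log β)) := by
  have hL : 0 < Real.log β := Real.log_pos hβ
  set L := Real.log β
  rcases eq_or_ne (lowerSlope φ) 0 with h0 | h0
  · rw [h0]
    simpa [Real.dimH_univ] using dimH_mono (Set.subset_univ (orbitLevelSet β φ))
  have key : ∀ (a : ℝ) (s : NNReal), 0 ≤ a → ENNReal.ofReal a < lowerSlope φ →
      L < s * (a + L) → dimH (orbitLevelSet β φ) ≤ s := fun a s ha haη hs =>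
    (dimH_frequently_lt_exp_le hβ ha hs).trans'
      (dimH_mono fun _ hx => ⟨hx.1, frequently_lt_exp_of_mem_orbitLevelSet ha haη hx⟩)
  refine le_of_forall_gt_imp_ge_of_dense fun d hd => ?_
  induction d with
  | top => exact le_top
  | coe s => ?_
  have hs0 : 0 < (s : ℝ) := by
    have : (0 : ℝ≥0∞) < s := lt_of_le_of_lt zero_le hd
    exact_mod_cast this
  by_cases ht : lowerSlope φ = ⊤
  · refine key (L / s) s (by positivity) (by rw [ht]; exact ENNReal.ofReal_lt_top) ?_
    rw [mul_add, mul_div_cancel₀ _ hs0.ne']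
    nlinarith
  · obtain ⟨η, hη⟩ : ∃ η : NNReal, (η : ℝ≥0∞) = lowerSlope φ := ⟨_, ENNReal.coe_toNNReal ht⟩
    have hη0 : 0 < (η : ℝ) := by
      rw [← hη] at h0
      exact_mod_cast pos_iff_ne_zero.2 (ENNReal.coe_ne_zero.1 h0)
    rw [← hη, one_div_one_add_div_ofReal hL, ← ENNReal.ofReal_coe_nnreal,
      ENNReal.ofReal_lt_ofReal_iff hs0, div_lt_iff₀ (by positivity)] at hd
    have h1 : L / s - L < η := by
      rw [sub_lt_iff_lt_add, div_lt_iff₀ hs0]; linarith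
    obtain ⟨a, ha, haη⟩ := exists_between (max_lt hη0 h1)
    refine key a s ((le_max_left _ _).trans ha.le) ?_ ?_
    · rw [← hη, ← ENNReal.ofReal_coe_nnreal, ENNReal.ofReal_lt_ofReal_iff hη0]; exact haη
    · have := (le_max_right _ _).trans_lt ha
      rw [sub_lt_iff_lt_add, div_lt_iff₀ hs0] at this
      linarith

/-! ### Membership criterion and concatenation of full blocks -/

/-- The additive loss C disappears after division by φ(n), which tends to infinity. -/
lemma mem_orbitLevelSet_of_bounds {β x C : ℝ} {φ : ℕ → ℝ} (hpos : ∀ n : ℕ, 1 ≤ n → 0 < φ n)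
    (htop : Tendsto φ atTop atTop) (hx : x ∈ Set.Ico (0 : ℝ) 1)
    (hlow : ∀ n : ℕ, 1 ≤ n → Real.exp (-φ n - C) ≤ (betaT β)^[n] x)
    (hup : ∃ᶠ n : ℕ in atTop, (betaT β)^[n] x ≤ Real.exp (-φ n)) : x ∈ orbitLevelSet β φ := by
  have hlog : ∀ n : ℕ, 1 ≤ n → extLog ((betaT β)^[n] x) / (φ n : EReal) =
      ((Real.log ((betaT β)^[n] x) / φ n : ℝ) : EReal) := by
    intro n hn
    rw [extLog, ENNReal.log_ofReal_of_pos ((Real.exp_pos _).trans_le (hlow n hn)), EReal.coe_div]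
  refine ⟨hx, le_antisymm ?_ ?_⟩
  · refine liminf_le_of_frequently_le' ((hup.and_eventually (eventually_ge_atTop 1)).mono ?_)
    rintro n ⟨hn, hn1⟩
    have h0 := (Real.exp_pos _).trans_le (hlow n hn1)
    rw [hlog n hn1]
    have : Real.log ((betaT β)^[n] x) / φ n ≤ -1 := by
      rw [div_le_iff₀ (hpos n hn1)]
      linarith [(Real.log_le_iff_le_exp h0).2 hn]
    exact EReal.coe_le_coe_iff.2 this
  · have h1 : Tendsto (fun n => ((-1 - C / φ n : ℝ) : EReal)) atTop (nhds ((-1 : ℝ) : EReal)) := by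
      refine (continuous_coe_real_ereal.tendsto _).comp ?_
      simpa using (htop.const_div_atTop C).const_sub (-1)
    have h2 := h1.liminf_eq
    change _ = (-1 : EReal) at h2
    rw [← h2]
    refine liminf_le_liminf ((eventually_ge_atTop 1).mono fun n hn1 => ?_)
    have h0 := (Real.exp_pos _).trans_le (hlow n hn1)
    have hφ := hpos n hn1
    rw [hlog n hn1]
    refine EReal.coe_le_coe_iff.2 ?_
    have e : -1 - C / φ n = (-φ n - C) / φ n := by field_simp
    rw [e]
    gcongr
    exact (Real.le_log_iff_exp_le h0).2 (hlow n hn1)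

/-- Finite concatenation of `n` blocks with endpoints `p j, p (j + 1), …`. -/
noncomputable def blockApprox (β : ℝ) (len : ℕ → ℕ) (p : ℕ → ℝ) : ℕ → ℕ → ℝ
  | 0, _ => 0
  | n + 1, j => p j + blockApprox β len p n (j + 1) / β ^ len j

/-- The point whose expansion concatenates the blocks with endpoints `p j, p (j + 1), …`. -/
noncomputable def blockPoint (β : ℝ) (len : ℕ → ℕ) (p : ℕ → ℝ) (j : ℕ) : ℝ :=
  ⨆ n, blockApprox β len p n j

section Concatenation

variable {β : ℝ} {len : ℕ → ℕ} {p : ℕ → ℝ}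

lemma blockApprox_mem (hβ : 1 < β) (hp : ∀ j, IsFullEndpoint β (len j) (p j)) (n j : ℕ) :
    blockApprox β len p n j ∈ Set.Icc (0 : ℝ) 1 := by
  induction n generalizing j with
  | zero => simp [blockApprox]
  | succ n ih =>
    have h0 : 0 < β ^ len j := by positivity
    have h1 : blockApprox β len p n (j + 1) / β ^ len j ≤ 1 / β ^ len j := by
      gcongr; exact (ih _).2
    have h2 := div_nonneg (ih (j + 1)).1 h0.le
    have h3 : 0 < 1 / β ^ len j := by positivity
    have := (hp j).le
    have := (hp j).lt
    simp only [blockApprox, Set.mem_Icc]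
    constructor <;> linarith

lemma blockApprox_monotone (hβ : 1 < β) (hp : ∀ j, IsFullEndpoint β (len j) (p j)) (j : ℕ) :
    Monotone fun n => blockApprox β len p n j := by
  refine monotone_nat_of_le_succ fun n => ?_
  induction n generalizing j with
  | zero => exact (blockApprox_mem hβ hp 1 j).1
  | succ n ih =>
    simp only [blockApprox]
    have := ih (j + 1)
    simp only [blockApprox] at this
    gcongr

lemma tendsto_blockApprox (hβ : 1 < β) (hp : ∀ j, IsFullEndpoint β (len j) (p j)) (j : ℕ) :
    Tendsto (fun n => blockApprox β len p n j) atTop (nhds (blockPoint β len p j)) :=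
  tendsto_atTop_ciSup (blockApprox_monotone hβ hp j)
    ⟨1, by rintro _ ⟨n, rfl⟩; exact (blockApprox_mem hβ hp n j).2⟩

lemma blockPoint_eq (hβ : 1 < β) (hp : ∀ j, IsFullEndpoint β (len j) (p j)) (j : ℕ) :
    blockPoint β len p j = p j + blockPoint β len p (j + 1) / β ^ len j :=
  tendsto_nhds_unique ((tendsto_add_atTop_iff_nat 1).2 (tendsto_blockApprox hβ hp j))
    (((tendsto_blockApprox hβ hp (j + 1)).div_const _).const_add (p j))

/-- The limit of the approximants is a priori only at most 1; the strict inequality in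
`IsFullEndpoint.lt` keeps every tail below 1, so that the iteration formula of a full cylinder
applies to it. -/
lemma blockPoint_mem (hβ : 1 < β) (hp : ∀ j, IsFullEndpoint β (len j) (p j)) (j : ℕ) :
    blockPoint β len p j ∈ Set.Ico (p j) 1 := by
  have h : ∀ j, blockPoint β len p j ∈ Set.Icc (0 : ℝ) 1 := fun j =>
    isClosed_Icc.mem_of_tendsto (tendsto_blockApprox hβ hp j)
      (Eventually.of_forall fun n => blockApprox_mem hβ hp n j)
  have h0 : 0 < β ^ len j := by positivity
  have h1 : blockPoint β len p (j + 1) / β ^ len j ≤ 1 / β ^ len j := by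
    gcongr; exact (h _).2
  have h2 := div_nonneg (h (j + 1)).1 h0.le
  rw [blockPoint_eq hβ hp]
  exact ⟨by linarith, by linarith [(hp j).lt]⟩

lemma blockPoint_mem_Ico (hβ : 1 < β) (hp : ∀ j, IsFullEndpoint β (len j) (p j)) (j : ℕ) :
    blockPoint β len p j ∈ Set.Ico (0 : ℝ) 1 := by
  have h0 : 0 < 1 / β ^ len j := by positivity
  have := blockPoint_mem hβ hp j
  exact ⟨by linarith [(hp j).le, this.1], this.2⟩

lemma betaT_iterate_blockPoint (hβ : 1 < β) (hp : ∀ j, IsFullEndpoint β (len j) (p j)) (j : ℕ) :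
    (betaT β)^[len j] (blockPoint β len p j) = blockPoint β len p (j + 1) := by
  rw [blockPoint_eq hβ hp j]
  exact (hp j).iterate _ (blockPoint_mem_Ico hβ hp (j + 1))

lemma betaT_iterate_blockPoint_zero (hβ : 1 < β) (hp : ∀ j, IsFullEndpoint β (len j) (p j))
    {t : ℕ → ℕ} (ht₀ : t 0 = 0) (ht : ∀ j, t (j + 1) = t j + len j) (j : ℕ) :
    (betaT β)^[t j] (blockPoint β len p 0) = blockPoint β len p j := by
  induction j with
  | zero => simp [ht₀]
  | succ j ih => rw [ht, add_comm, Function.iterate_add_apply, ih, betaT_iterate_blockPoint hβ hp]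

end Concatenation

lemma betaT_one_div_add {β t : ℝ} (hβ : 1 < β) (ht : t ∈ Set.Ico (0 : ℝ) 1) (L : ℕ) :
    betaT β (1 / β + t / β ^ (L + 1)) = t / β ^ L := by
  have hβ0 : 0 < β := by linarith
  have hLp : 1 ≤ β ^ L := one_le_pow₀ hβ.le
  have e : β * (1 / β + t / β ^ (L + 1)) = 1 + t / β ^ L := by rw [pow_succ]; field_simp
  have h1 : 0 ≤ t / β ^ L := div_nonneg ht.1 (by positivity)
  have h2 : t / β ^ L < 1 := by rw [div_lt_one (by positivity)]; linarith [ht.2]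
  rw [betaT_eq_of_floor (k := 1), e]
  · simp
  · rw [e]; simpa using h1
  · rw [e]; push_cast; linarith

/-- The word `1 0 ⋯ 0` is full as soon as it is long enough. -/
lemma isFullEndpoint_one_div {β : ℝ} (hβ : 1 < β) {L : ℕ} (hL : 1 / β + 1 / β ^ (L + 1) < 1) :
    IsFullEndpoint β (L + 1) (1 / β) := by
  have hβ0 : 0 < β := by linarith
  refine ⟨one_div_le_one_div_of_le hβ0 (le_self_pow₀ hβ.le (by omega)), hL, fun t ht => ?_⟩
  have e : β ^ L * (t / β ^ L) = t := mul_div_cancel₀ _ (by positivity)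
  rw [Function.iterate_succ_apply, betaT_one_div_add hβ ht,
    betaT_iterate_eq_mul hβ.le (div_nonneg ht.1 (by positivity)) _ (by rw [e]; exact ht.2), e]

/-! ### Scheduling free and special blocks -/

/-- A schedule of free blocks of length `m` and special blocks, in which `f j` counts the free
blocks among the first `j` blocks and `t j` is the position where block `j` starts. -/
lemma exists_schedule {m : ℕ} (hm : 1 ≤ m) {φ : ℕ → ℝ} {lb η θ : ℝ} (hlb : 0 < lb) (hη : 0 < η)
    (hθ0 : 0 < θ) (hθ1 : θ < 1) (hpos : ∀ n : ℕ, 1 ≤ n → 0 < φ n)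
    (hmono : ∀ m n : ℕ, 1 ≤ m → m ≤ n → φ m ≤ φ n)
    (hfreq : ∃ᶠ n : ℕ in atTop, φ n ≤ η * n) (L₀ : ℕ) :
    ∃ (f t : ℕ → ℕ) (sp : ℕ → Prop) (C : ℝ), f 0 = 0 ∧ t 0 = 0 ∧
      (∀ j, sp j → f (j + 1) = f j ∧ t (j + 1) = t j + (⌈φ (t j + 1) / lb⌉₊ + L₀ + 1)) ∧
      (∀ j, ¬ sp j → f (j + 1) = f j + 1 ∧ t (j + 1) = t j + m) ∧
      (∃ᶠ j in atTop, sp j) ∧ ∀ j, θ / (1 + η / lb) * t j ≤ m * f j + C := by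
  classical
  set P : ℕ × ℕ → Prop := fun a => φ (a.2 + 1) ≤ η * (a.2 + 1 + m) ∧ θ * a.2 ≤ m * a.1
  set step : ℕ × ℕ → ℕ × ℕ := fun a =>
    if P a then (a.1, a.2 + (⌈φ (a.2 + 1) / lb⌉₊ + L₀ + 1)) else (a.1 + 1, a.2 + m)
  set s : ℕ → ℕ × ℕ := fun j => step^[j] (0, 0)
  have hs : ∀ j, s (j + 1) = step (s j) := fun j => Function.iterate_succ_apply' _ _ _
  have hsp : ∀ j, P (s j) → (s (j + 1)).1 = (s j).1 ∧
      (s (j + 1)).2 = (s j).2 + (⌈φ ((s j).2 + 1) / lb⌉₊ + L₀ + 1) := by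
    intro j hj; rw [hs]; simp only [step, if_pos hj, and_self]
  have hfree : ∀ j, ¬ P (s j) → (s (j + 1)).1 = (s j).1 + 1 ∧ (s (j + 1)).2 = (s j).2 + m := by
    intro j hj; rw [hs]; simp only [step, if_neg hj, and_self]
  set ρ := θ / (1 + η / lb)
  have hρ0 : 0 < ρ := by positivity
  have hρθ : ρ * (1 + η / lb) = θ := div_mul_cancel₀ _ (by positivity)
  have hρ1 : ρ ≤ 1 := by
    have : 0 ≤ ρ * (η / lb) := by positivity
    linarith
  -- The last constant is ρ times the bounded overhead of one special block: slack, rounding and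
  -- padding.
  refine ⟨fun j => (s j).1, fun j => (s j).2, fun j => P (s j), ρ * (η / lb * (1 + m) + L₀ + 2),
    rfl, rfl, hsp, hfree, ?_, ?_⟩
  · by_contra hcon
    rw [not_frequently, eventually_atTop] at hcon
    obtain ⟨J, hJ⟩ := hcon
    set a := (s J).1
    set b := (s J).2
    have hk : ∀ k, s (J + k) = (a + k, b + m * k) := by
      intro k
      induction k with
      | zero => simp [a, b]
      | succ k ih =>
        have h := hfree (J + k) (hJ _ (by omega))
        rw [ih] at h
        rw [← add_assoc]
        refine Prod.ext ?_ ?_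
        · rw [h.1]; ring
        · rw [h.2]; ring
    -- If only free blocks followed J, the proportion condition would hold after K of them; k below
    -- is then chosen so that the position is within m of a good index n.
    obtain ⟨K, hK⟩ := exists_nat_gt (θ * b / (1 - θ))
    obtain ⟨n, hn, hφn⟩ := frequently_atTop.1 hfreq (b + 1 + m * K)
    set k := (n - b - 1) / m
    have hKk : K ≤ k := (Nat.le_div_iff_mul_le (by omega)).2 (by rw [mul_comm]; omega)
    have hdm : m * k + (n - b - 1) % m = n - b - 1 := Nat.div_add_mod (n - b - 1) m
    have hmod := Nat.mod_lt (n - b - 1) (show 0 < m by omega)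
    refine hJ (J + k) (by omega) ?_
    rw [hk]
    refine ⟨?_, ?_⟩
    · have h1 : b + m * k + 1 ≤ n := by omega
      have h2 : n ≤ b + m * k + 1 + m := by omega
      calc φ (b + m * k + 1) ≤ φ n := hmono _ _ (by omega) h1
        _ ≤ η * n := hφn
        _ ≤ η * ((b + m * k + 1 + m : ℕ) : ℝ) := by gcongr
        _ = _ := by push_cast; ring
    · have h1 : θ * b < (1 - θ) * k := by
        rw [div_lt_iff₀ (by linarith)] at hK
        have : (K : ℝ) ≤ k := by exact_mod_cast hKk
        nlinarith
      have h2 : (1 - θ) * k ≤ (1 - θ) * (m * k) := by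
        have : (1 : ℝ) ≤ m := by exact_mod_cast hm
        have hk0 : (0 : ℝ) ≤ k := by positivity
        have : (1 : ℝ) * k ≤ m * k := by gcongr
        have h0 : 0 ≤ 1 - θ := by linarith
        gcongr
        linarith
      have h3 : (0 : ℝ) ≤ m * a := by positivity
      push_cast
      nlinarith
  · intro j
    induction j with
    | zero =>
      have : 0 ≤ ρ * (η / lb * (1 + m) + L₀ + 2) := by positivity
      simpa [s] using this
    | succ j ih =>
      by_cases hj : P (s j)
      -- A special block multiplies the position by at most 1 + η/lb, up to a constant, and ρ(1 +
      -- η/lb) = θ: the invariant follows from the proportion condition alone, so losses do not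
      -- accumulate.
      · obtain ⟨h1, h2⟩ := hsp j hj
        simp only [h1, h2]
        have hc := Nat.ceil_lt_add_one (div_nonneg (hpos ((s j).2 + 1) (by omega)).le hlb.le)
        have hd : φ ((s j).2 + 1) / lb ≤ η / lb * ((s j).2 + 1 + m) := by
          rw [div_mul_eq_mul_div]; gcongr; exact hj.1
        have h3 : ((s j).2 : ℝ) + (⌈φ ((s j).2 + 1) / lb⌉₊ + L₀ + 1) ≤
            (1 + η / lb) * (s j).2 + (η / lb * (1 + m) + L₀ + 2) := by linarith
        have h4 := mul_le_mul_of_nonneg_left h3 hρ0.le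
        have h5 := hj.2
        have e : ρ * ((1 + η / lb) * (s j).2 + (η / lb * (1 + m) + L₀ + 2)) =
            θ * (s j).2 + ρ * (η / lb * (1 + m) + L₀ + 2) := by rw [← hρθ]; ring
        rw [e] at h4
        push_cast
        linarith
      · obtain ⟨h1, h2⟩ := hfree j hj
        simp only [h1, h2]
        push_cast
        have : ρ * m ≤ 1 * m := by gcongr
        linarith

lemma exists_lt_succ_of_unbounded {t : ℕ → ℕ} (h₀ : t 0 = 0) {n : ℕ} (h : ∃ k, n < t k) :
    ∃ j, t j ≤ n ∧ n < t (j + 1) := by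
  classical
  have hne : Nat.find h ≠ 0 := by
    intro h1
    have := Nat.find_spec h
    rw [h1, h₀] at this
    omega
  obtain ⟨j, hj⟩ := Nat.exists_eq_succ_of_ne_zero hne
  refine ⟨j, not_lt.1 (Nat.find_min h (by omega)), ?_⟩
  have := Nat.find_spec h
  rwa [hj] at this

/-! ### Concatenated points lie in the level set -/

lemma blockPoint_mem_orbitLevelSet {β : ℝ} (hβ : 1 < β) {φ : ℕ → ℝ}
    (hpos : ∀ n : ℕ, 1 ≤ n → 0 < φ n) (hmono : ∀ m n : ℕ, 1 ≤ m → m ≤ n → φ m ≤ φ n)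
    (htop : Tendsto φ atTop atTop) {m L₀ : ℕ} (hm : 1 ≤ m) {len t : ℕ → ℕ} {p : ℕ → ℝ}
    {sp : ℕ → Prop} (hp : ∀ j, IsFullEndpoint β (len j) (p j)) (hpm : ∀ j, 1 / β ^ m ≤ p j)
    (ht₀ : t 0 = 0) (ht : ∀ j, t (j + 1) = t j + len j)
    (hspec : ∀ j, sp j → p j = 1 / β ∧ len j = ⌈φ (t j + 1) / Real.log β⌉₊ + L₀ + 1)
    (hfree : ∀ j, ¬ sp j → len j = m) (hsp : ∃ᶠ j in atTop, sp j) :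
    blockPoint β len p 0 ∈ orbitLevelSet β φ := by
  have hβ0 : 0 < β := by linarith
  have hlb : 0 < Real.log β := Real.log_pos hβ
  have hexp : ∀ k : ℕ, 1 / β ^ k = Real.exp (-(k * Real.log β)) := by
    intro k
    rw [Real.exp_neg, Real.exp_nat_mul, Real.exp_log hβ0, one_div]
  have hlen : ∀ j, 1 ≤ len j := by
    intro j
    by_cases h : sp j
    · rw [(hspec j h).2]; omega
    · rw [hfree j h]; exact hm
  have hjt : ∀ j, j ≤ t j := by
    intro j
    induction j with
    | zero => omega
    | succ j ih => have := hlen j; rw [ht]; omega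
  have hx := blockPoint_mem_Ico hβ hp 0
  have hX := betaT_iterate_blockPoint_zero hβ hp ht₀ ht
  set x := blockPoint β len p 0
  refine mem_orbitLevelSet_of_bounds (C := (2 * m + L₀ + 1) * Real.log β) hpos htop hx ?_ ?_
  · intro n hn
    obtain ⟨j, hj, hj'⟩ := exists_lt_succ_of_unbounded ht₀ ⟨n + 1, hjt (n + 1)⟩
    have hφ := hpos n hn
    have hk : ∃ k : ℕ, 1 / β ^ k ≤ (betaT β)^[n] x ∧
        k * Real.log β ≤ φ n + (2 * m + L₀ + 1) * Real.log β := by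
      -- The next block starts with a point of size at least β^(-m), and one application of T
      -- expands by at most β.
      have hge : 1 / β ^ (m + (t (j + 1) - n)) ≤ (betaT β)^[n] x := by
        have h1 := betaT_iterate_le hβ0.le (betaT_iterate_mem (β := β) hx n) (t (j + 1) - n)
        rw [← Function.iterate_add_apply, Nat.sub_add_cancel hj'.le, hX] at h1
        have h2 := (hpm (j + 1)).trans (blockPoint_mem hβ hp (j + 1)).1
        rw [div_le_iff₀ (by positivity), pow_add, mul_left_comm]
        rw [div_le_iff₀ (by positivity)] at h2
        have h3 := mul_le_mul_of_nonneg_right h1 (pow_pos hβ0 m).le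
        linarith
      have hm0 : 0 ≤ m * Real.log β := by positivity
      have hL0 : 0 ≤ L₀ * Real.log β := by positivity
      by_cases h : sp j
      · obtain ⟨-, hl⟩ := hspec j h
        -- The start of a special block is treated apart: the block is tuned to φ(t j + 1), which is
        -- at most φ(n) only for n > t j. At n = t j the leading digit 1 keeps the orbit large.
        rcases eq_or_lt_of_le hj with he | hlt
        · refine ⟨m, ?_, by linarith⟩
          rw [← he, hX]
          exact (hpm j).trans (blockPoint_mem hβ hp j).1
        · refine ⟨_, hge, ?_⟩
          have h1 : t (j + 1) - n ≤ ⌈φ (t j + 1) / Real.log β⌉₊ + L₀ := by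
            have := ht j; omega
          have hc := Nat.ceil_lt_add_one (div_nonneg (hpos (t j + 1) (by omega)).le hlb.le)
          have h2 : ((t (j + 1) - n : ℕ) : ℝ) ≤ φ (t j + 1) / Real.log β + 1 + L₀ := by
            calc ((t (j + 1) - n : ℕ) : ℝ) ≤ ((⌈φ (t j + 1) / Real.log β⌉₊ + L₀ : ℕ) : ℝ) := by
                  exact_mod_cast h1
              _ ≤ _ := by push_cast; linarith
          have h3 := mul_le_mul_of_nonneg_right h2 hlb.le
          have e : (φ (t j + 1) / Real.log β + 1 + L₀) * Real.log β =
              φ (t j + 1) + (1 + L₀) * Real.log β := by field_simp; ring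
          have h4 := hmono (t j + 1) n (by omega) hlt
          rw [e] at h3
          push_cast
          linarith
      · refine ⟨_, hge, ?_⟩
        have h1 : t (j + 1) - n ≤ m := by have := ht j; have := hfree j h; omega
        have h2 : ((t (j + 1) - n : ℕ) : ℝ) ≤ m := by exact_mod_cast h1
        have h3 := mul_le_mul_of_nonneg_right h2 hlb.le
        push_cast
        linarith
    obtain ⟨k, hk, hk'⟩ := hk
    rw [hexp] at hk
    refine le_trans (Real.exp_le_exp.2 ?_) hk
    linarith
  · refine frequently_atTop.2 fun N => ?_
    obtain ⟨j, hj, hs⟩ := frequently_atTop.1 hsp N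
    -- One step past the start, the leading 1 has been consumed and only zeros precede the next
    -- block.
    refine ⟨t j + 1, by have := hjt j; omega, ?_⟩
    obtain ⟨hpj, hl⟩ := hspec j hs
    have hY := blockPoint_mem_Ico hβ hp (j + 1)
    rw [Function.iterate_succ_apply', hX, blockPoint_eq hβ hp, hpj, hl, betaT_one_div_add hβ hY]
    calc _ ≤ 1 / β ^ (⌈φ (t j + 1) / Real.log β⌉₊ + L₀) := by gcongr; exact hY.2.le
      _ ≤ _ := by
        rw [hexp]
        have h1 := Nat.le_ceil (φ (t j + 1) / Real.log β)
        rw [div_le_iff₀ hlb] at h1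
        have hL0 : 0 ≤ L₀ * Real.log β := by positivity
        apply Real.exp_le_exp.2
        push_cast
        linarith

/-! ### Separation of coded points -/

section Separation

variable {β : ℝ} {len t : ℕ → ℕ} {p p' : ℕ → ℝ}

lemma blockPoint_sub_of_agree (hβ : 1 < β) (hp : ∀ j, IsFullEndpoint β (len j) (p j))
    (hp' : ∀ j, IsFullEndpoint β (len j) (p' j)) (ht₀ : t 0 = 0)
    (ht : ∀ j, t (j + 1) = t j + len j) {j : ℕ} (h : ∀ l < j, p l = p' l) :
    blockPoint β len p 0 - blockPoint β len p' 0 =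
      (blockPoint β len p j - blockPoint β len p' j) / β ^ t j := by
  induction j with
  | zero => simp [ht₀]
  | succ j ih =>
    rw [ih fun l hl => h l (by omega), blockPoint_eq hβ hp j, blockPoint_eq hβ hp' j,
      h j (by omega), ht, pow_add]
    field_simp
    ring

/-- Distinct full cylinders of order m may be adjacent, but in the right-hand one the next block
keeps the point β^(-2m) away from its left end. -/
lemma le_abs_sub_blockPoint (hβ : 1 < β) (hp : ∀ j, IsFullEndpoint β (len j) (p j))
    (hp' : ∀ j, IsFullEndpoint β (len j) (p' j)) {m j : ℕ} (hm : len j = m)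
    (hpm : 1 / β ^ m ≤ p (j + 1)) (hpm' : 1 / β ^ m ≤ p' (j + 1)) (h : p j ≠ p' j) :
    1 / β ^ (m + m) ≤ |blockPoint β len p j - blockPoint β len p' j| := by
  have hβm : 0 < β ^ m := by positivity
  have key : ∀ a a' z z' : ℝ, IsFullEndpoint β m a → IsFullEndpoint β m a' → a < a' → z < 1 →
      1 / β ^ m ≤ z' → 1 / β ^ (m + m) ≤ (a' + z' / β ^ m) - (a + z / β ^ m) := by
    intro a a' z z' ha ha' hlt hz hz'
    have h1 := ha.separated hβ ha' hlt
    have h2 : z / β ^ m ≤ 1 / β ^ m := by gcongr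
    have h3 : 1 / β ^ (m + m) ≤ z' / β ^ m := by rw [pow_add, ← div_div]; gcongr
    linarith
  have h1 := hp j
  have h1' := hp' j
  have h2 := blockPoint_mem hβ hp (j + 1)
  have h2' := blockPoint_mem hβ hp' (j + 1)
  rw [blockPoint_eq hβ hp j, blockPoint_eq hβ hp' j]
  rw [hm] at h1 h1' ⊢
  rcases lt_or_gt_of_ne h with hlt | hlt
  · rw [abs_sub_comm]
    exact (key _ _ _ _ h1 h1' hlt h2.2 (hpm'.trans h2'.1)).trans (le_abs_self _)
  · exact (key _ _ _ _ h1' h1 hlt h2'.2 (hpm.trans h2.1)).trans (le_abs_self _)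

end Separation

/-! ### Base-M digits -/

/-- The `i`-th digit of `y` in base `M`. -/
noncomputable def baseDigit (M : ℕ) (y : ℝ) (i : ℕ) : ℕ := ⌊M * (betaT M)^[i] y⌋₊

lemma baseDigit_lt {M : ℕ} (hM : 0 < M) {y : ℝ} (hy : y ∈ Set.Ico (0 : ℝ) 1) (i : ℕ) :
    baseDigit M y i < M := by
  have h := betaT_iterate_mem (β := M) hy i
  have hM' : (0 : ℝ) < M := by exact_mod_cast hM
  rw [baseDigit, Nat.floor_lt (mul_nonneg hM'.le h.1)]
  nlinarith [h.2]

lemma abs_sub_le_of_baseDigit_agree {M : ℕ} (hM : 0 < M) {y y' : ℝ} (hy : y ∈ Set.Ico (0 : ℝ) 1)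
    (hy' : y' ∈ Set.Ico (0 : ℝ) 1) {i : ℕ} (h : ∀ k < i, baseDigit M y k = baseDigit M y' k) :
    |y - y'| ≤ 1 / (M : ℝ) ^ i := by
  have hM' : (0 : ℝ) < M := by exact_mod_cast hM
  have hstep : ∀ z ∈ Set.Ico (0 : ℝ) 1, ∀ k,
      (betaT M)^[k + 1] z = M * (betaT M)^[k] z - baseDigit M z k := by
    intro z hz k
    rw [Function.iterate_succ_apply', betaT, baseDigit,
      natCast_floor_eq_intCast_floor (mul_nonneg hM'.le (betaT_iterate_mem hz k).1)]
  have key : (betaT M)^[i] y - (betaT M)^[i] y' = M ^ i * (y - y') := by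
    induction i with
    | zero => simp
    | succ i ih =>
      rw [hstep y hy, hstep y' hy', h i (by omega), sub_sub_sub_cancel_right, ← mul_sub,
        ih fun k hk => h k (by omega)]
      ring
  have h1 := betaT_iterate_mem (β := M) hy i
  have h2 := betaT_iterate_mem (β := M) hy' i
  rw [le_div_iff₀ (by positivity), ← abs_of_pos (show (0 : ℝ) < M ^ i by positivity), ← abs_mul,
    mul_comm, ← key, abs_le]
  exact ⟨by linarith [h1.1, h2.2], by linarith [h1.2, h2.1]⟩

lemma exists_baseDigit_ne {M : ℕ} (hM : 2 ≤ M) {y y' : ℝ} (hy : y ∈ Set.Ico (0 : ℝ) 1)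
    (hy' : y' ∈ Set.Ico (0 : ℝ) 1) (hne : y ≠ y') :
    ∃ i, baseDigit M y i ≠ baseDigit M y' i ∧
      (∀ k < i, baseDigit M y k = baseDigit M y' k) ∧ |y - y'| ≤ 1 / (M : ℝ) ^ i := by
  classical
  have hM1 : (1 : ℝ) < M := by exact_mod_cast hM
  have hex : ∃ i, baseDigit M y i ≠ baseDigit M y' i := by
    by_contra! hcon
    have hlim : Tendsto (fun i : ℕ => 1 / (M : ℝ) ^ i) atTop (nhds 0) := by
      simpa [Function.comp_def] using
        tendsto_inv_atTop_zero.comp (tendsto_pow_atTop_atTop_of_one_lt hM1)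
    have := ge_of_tendsto' hlim fun i =>
      abs_sub_le_of_baseDigit_agree (by omega) hy hy' fun k (_ : k < i) => hcon k
    exact hne (sub_eq_zero.1 (abs_nonpos_iff.1 this))
  have hagree : ∀ k < Nat.find hex, baseDigit M y k = baseDigit M y' k := fun k hk =>
    not_not.1 (Nat.find_min hex hk)
  exact ⟨Nat.find hex, Nat.find_spec hex, hagree,
    abs_sub_le_of_baseDigit_agree (by omega) hy hy' hagree⟩

/-! ### The coding map and the lower bound -/

/-- An injection of `[0,1)` into the level set with Hölder inverse. -/
lemma exists_expanding_map {β η θ r : ℝ} (hβ : 1 < β) {φ : ℕ → ℝ}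
    (hpos : ∀ n : ℕ, 1 ≤ n → 0 < φ n) (hmono : ∀ m n : ℕ, 1 ≤ m → m ≤ n → φ m ≤ φ n)
    (htop : Tendsto φ atTop atTop) (hη : 0 < η) (hθ0 : 0 < θ) (hθ1 : θ < 1)
    (hfreq : ∃ᶠ n : ℕ in atTop, φ n ≤ η * n)
    (hr : 0 < r) (hrθ : r ≤ θ * (θ / (1 + η / Real.log β))) :
    ∃ (g : ℝ → ℝ) (C : ℝ), 0 ≤ C ∧ (∀ y ∈ Set.Ico (0 : ℝ) 1, g y ∈ orbitLevelSet β φ) ∧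
      ∀ y ∈ Set.Ico (0 : ℝ) 1, ∀ y' ∈ Set.Ico (0 : ℝ) 1, |y - y'| ≤ C * |g y - g y'| ^ r := by
  classical
  have hβ0 : 0 < β := by linarith
  have hlb : 0 < Real.log β := Real.log_pos hβ
  set lb := Real.log β
  -- Here B = β^θ. One factor θ in the bound on r pays for this loss of entropy, the other for the
  -- proportion θ in the schedule.
  have hB : 1 < Real.exp (θ * lb) := Real.one_lt_exp_iff.2 (by positivity)
  have hBβ : Real.exp (θ * lb) < β := by
    rw [← Real.lt_log_iff_exp_lt hβ0]; nlinarith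
  obtain ⟨m, M, e, hm, hMB, he, hfull⟩ := exists_many_fullEndpoints hB hBβ
  have hM : 2 ≤ M := by
    have : (1 : ℝ) < M := (one_lt_pow₀ hB (by omega)).trans_le hMB
    exact_mod_cast this
  obtain ⟨L₀, hL₀⟩ : ∃ L₀ : ℕ, 1 / β + (1 / β) ^ L₀ < 1 := by
    have h1 : 1 / β < 1 := by rw [div_lt_one hβ0]; exact hβ
    obtain ⟨n, hn⟩ := exists_pow_lt_of_lt_one (sub_pos.2 h1) h1
    exact ⟨n, by linarith⟩
  obtain ⟨f, t, sp, C, hf0, ht0, hsp, hfr, hspf, hC⟩ :=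
    exists_schedule hm hlb hη hθ0 hθ1 hpos hmono hfreq L₀
  set len : ℕ → ℕ := fun j => if sp j then ⌈φ (t j + 1) / lb⌉₊ + L₀ + 1 else m
  -- The last branch is a default that makes every block legitimate for all real y; it is never
  -- taken for y in [0,1).
  set p : ℝ → ℕ → ℝ := fun y j => if sp j then 1 / β else
    if h : baseDigit M y (f j) < M then e ⟨_, h⟩ else e ⟨0, by omega⟩
  have ht : ∀ j, t (j + 1) = t j + len j := by
    intro j
    by_cases h : sp j
    · simp only [len, if_pos h]; exact (hsp j h).2
    · simp only [len, if_neg h]; exact (hfr j h).2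
  have hlen : ∀ j, ¬ sp j → len j = m := fun j h => if_neg h
  have hspec : ∀ y j, sp j → p y j = 1 / β ∧ len j = ⌈φ (t j + 1) / lb⌉₊ + L₀ + 1 :=
    fun y j h => ⟨if_pos h, if_pos h⟩
  have hp : ∀ y j, IsFullEndpoint β (len j) (p y j) := by
    intro y j
    by_cases h : sp j
    · rw [(hspec y j h).1, (hspec y j h).2]
      apply isFullEndpoint_one_div hβ
      refine lt_of_le_of_lt ?_ hL₀
      rw [one_div_pow]
      gcongr
      · exact hβ.le
      · omega
    · rw [hlen j h]
      simp only [p, if_neg h]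
      split_ifs <;> exact hfull _
  have hpm : ∀ y j, 1 / β ^ m ≤ p y j := by
    intro y j
    by_cases h : sp j
    · rw [(hspec y j h).1]
      exact one_div_le_one_div_of_le hβ0 (le_self_pow₀ hβ.le (by omega))
    · have := (hp y j).le
      rwa [hlen j h] at this
  have hfstep : ∀ j, f j ≤ f (j + 1) := by
    intro j
    by_cases h : sp j
    · exact (hsp j h).1.ge
    · have := (hfr j h).1; omega
  have hfmono := monotone_nat_of_le_succ hfstep
  have hlen1 : ∀ j, 1 ≤ len j := by
    intro j
    simp only [len]; split_ifs <;> omega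
  have hjt : ∀ j, j ≤ t j := by
    intro j
    induction j with
    | zero => omega
    | succ j ih => have := hlen1 j; rw [ht]; omega
  set ρ := θ / (1 + η / lb)
  have hρ0 : 0 < ρ := by positivity
  have hfunb : ∀ n, ∃ k, n < f k := by
    intro n
    obtain ⟨k, hk⟩ := exists_nat_gt ((m * n + C) / ρ)
    refine ⟨k, ?_⟩
    by_contra! hle
    rw [div_lt_iff₀ hρ0] at hk
    have h1 : ρ * k ≤ ρ * t k := by gcongr; exact hjt k
    have h2 : (m : ℝ) * f k ≤ m * n := by gcongr
    linarith [hC k]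
  -- In the constant, θ·lb·C comes from the additive error of the schedule and r·lb·(m + m) from the
  -- gap β^(-2m).
  refine ⟨fun y => blockPoint β len (p y) 0, Real.exp (θ * lb * C + r * lb * (m + m)),
    (Real.exp_pos _).le, fun y _ => blockPoint_mem_orbitLevelSet hβ hpos hmono htop hm (hp y) (hpm y)
      ht0 ht (hspec y) hlen hspf, fun y hy y' hy' => ?_⟩
  rcases eq_or_ne y y' with rfl | hne
  · simp [Real.zero_rpow hr.ne']
  obtain ⟨i, hi, hagree, hyy⟩ := exists_baseDigit_ne hM hy hy' hne
  obtain ⟨j, hj, hj'⟩ := exists_lt_succ_of_unbounded hf0 (hfunb i)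
  -- The block that carries the first differing digit raises the free count, so it is free.
  have hjsp : ¬ sp j := fun h => by have := (hsp j h).1; omega
  have hji : f j = i := by have := (hfr j hjsp).1; omega
  have hpj : ∀ (z : ℝ) (hz : z ∈ Set.Ico (0 : ℝ) 1) (l : ℕ), ¬ sp l →
      p z l = e ⟨baseDigit M z (f l), baseDigit_lt (by omega) hz _⟩ := by
    intro z hz l h
    have hlt : baseDigit M z (f l) < M := baseDigit_lt (by omega) hz _
    simp only [p, if_neg h, dif_pos hlt]
  have hpne : p y j ≠ p y' j := by
    rw [hpj y hy j hjsp, hpj y' hy' j hjsp]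
    intro h
    have := he h
    rw [Fin.mk.injEq, hji] at this
    exact hi this
  have hpeq : ∀ l < j, p y l = p y' l := by
    intro l hl
    by_cases h : sp l
    · rw [(hspec y l h).1, (hspec y' l h).1]
    · have h1 := hfmono (show l + 1 ≤ j from hl)
      have h2 := (hfr l h).1
      have h3 := hagree (f l) (by omega)
      rw [hpj y hy l h, hpj y' hy' l h]
      simp only [h3]
  have hlow := le_abs_sub_blockPoint hβ (hp y) (hp y') (hlen j hjsp) (hpm y _) (hpm y' _) hpne
  have hx : Real.exp (-(lb * (t j + (m + m)))) ≤
      |blockPoint β len (p y) 0 - blockPoint β len (p y') 0| := by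
    rw [blockPoint_sub_of_agree hβ (hp y) (hp y') ht0 ht hpeq, abs_div,
      abs_of_pos (show 0 < β ^ t j by positivity), le_div_iff₀ (by positivity)]
    refine le_trans (le_of_eq ?_) hlow
    rw [eq_div_iff (by positivity), ← Real.exp_log (pow_pos hβ0 (t j)),
      ← Real.exp_log (pow_pos hβ0 (m + m)), Real.log_pow, Real.log_pow, ← Real.exp_add,
      ← Real.exp_add, Real.exp_eq_one_iff]
    push_cast
    ring
  calc |y - y'| ≤ 1 / (M : ℝ) ^ i := hyy
    _ ≤ 1 / (Real.exp (θ * lb) ^ m) ^ i := by gcongr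
    _ = Real.exp (-(θ * lb * (m * i))) := by
      rw [← pow_mul, ← Real.exp_nat_mul, one_div, ← Real.exp_neg]
      push_cast
      ring_nf
    _ ≤ Real.exp (θ * lb * C + r * lb * (m + m) + -(lb * (t j + (m + m))) * r) := by
      apply Real.exp_le_exp.2
      have h1 := mul_le_mul_of_nonneg_left (hC j) (mul_pos hθ0 hlb).le
      rw [hji] at h1
      have h2 : r * (lb * t j) ≤ θ * ρ * (lb * t j) := by gcongr
      linarith
    _ = Real.exp (θ * lb * C + r * lb * (m + m)) * Real.exp (-(lb * (t j + (m + m)))) ^ r := by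
      rw [Real.exp_add, Real.exp_mul]
    _ ≤ _ := by gcongr

/-- The inverse of g is r-Hölder from the image of g onto [0,1), so 1 is at most the dimension of
that image divided by r. -/
lemma le_dimH_of_expanding {s : Set ℝ} {g : ℝ → ℝ} {C : ℝ} {r : NNReal} (hr : 0 < r) (hC : 0 ≤ C)
    (hg : ∀ y ∈ Set.Ico (0 : ℝ) 1, g y ∈ s)
    (h : ∀ y ∈ Set.Ico (0 : ℝ) 1, ∀ y' ∈ Set.Ico (0 : ℝ) 1, |y - y'| ≤ C * |g y - g y'| ^ (r : ℝ)) :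
    r ≤ dimH s := by
  have hinj : Set.InjOn g (Set.Ico 0 1) := by
    intro y hy y' hy' he
    have := h y hy y' hy'
    rw [he, sub_self, abs_zero, Real.zero_rpow (by exact_mod_cast hr.ne'), mul_zero] at this
    exact sub_eq_zero.1 (abs_nonpos_iff.1 this)
  have hleft : Set.LeftInvOn (Function.invFunOn g (Set.Ico 0 1)) g (Set.Ico 0 1) :=
    hinj.leftInvOn_invFunOn
  have hH : HolderOnWith C.toNNReal r (Function.invFunOn g (Set.Ico 0 1)) (g '' Set.Ico 0 1) := by
    rintro _ ⟨y, hy, rfl⟩ _ ⟨y', hy', rfl⟩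
    rw [hleft hy, hleft hy', edist_dist, edist_dist, Real.dist_eq, Real.dist_eq,
      ENNReal.ofReal_rpow_of_nonneg (abs_nonneg _) r.coe_nonneg]
    change _ ≤ ENNReal.ofReal C * _
    rw [← ENNReal.ofReal_mul hC]
    exact ENNReal.ofReal_le_ofReal (h y hy y' hy')
  have h1 := hH.dimH_image_le hr
  rw [hleft.image_image, Real.dimH_of_nonempty_interior (by simp), Module.finrank_self,
    Nat.cast_one, ENNReal.le_div_iff_mul_le (by simp [hr.ne']) (by simp), one_mul] at h1
  exact h1.trans (dimH_mono (Set.image_subset_iff.2 hg))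

lemma le_dimH_orbitLevelSet {β : ℝ} (hβ : 1 < β) {φ : ℕ → ℝ}
    (hpos : ∀ n : ℕ, 1 ≤ n → 0 < φ n) (hmono : ∀ m n : ℕ, 1 ≤ m → m ≤ n → φ m ≤ φ n)
    (htop : Tendsto φ atTop atTop) :
    1 / (1 + lowerSlope φ / ENNReal.ofReal (Real.log β)) ≤ dimH (orbitLevelSet β φ) := by
  have hL : 0 < Real.log β := Real.log_pos hβ
  by_cases ht : lowerSlope φ = ⊤
  · simp [ht, ENNReal.top_div_of_ne_top]
  obtain ⟨η, hη⟩ : ∃ η : NNReal, (η : ℝ≥0∞) = lowerSlope φ := ⟨_, ENNReal.coe_toNNReal ht⟩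
  rw [← hη, one_div_one_add_div_ofReal hL]
  refine le_of_forall_lt_imp_le_of_dense fun d hd => ?_
  obtain ⟨r, rfl⟩ : ∃ r : NNReal, (r : ℝ≥0∞) = d := ⟨_, ENNReal.coe_toNNReal hd.ne_top⟩
  rcases eq_or_ne r 0 with rfl | hr
  · simp
  have hr0 : (0 : ℝ) < r := by exact_mod_cast pos_iff_ne_zero.2 hr
  have hη0 : (0 : ℝ) ≤ η := η.coe_nonneg
  rw [← ENNReal.ofReal_coe_nnreal, ENNReal.ofReal_lt_ofReal_iff (by positivity),
    lt_div_iff₀ (by positivity)] at hd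
  obtain ⟨η', hηη', hη'⟩ : ∃ η' : ℝ, η < η' ∧ r * (Real.log β + η') < Real.log β := by
    have h1 : (η : ℝ) < Real.log β / r - Real.log β := by
      rw [lt_sub_iff_add_lt, lt_div_iff₀ hr0]; linarith
    obtain ⟨η', h2, h3⟩ := exists_between h1
    rw [lt_sub_iff_add_lt, lt_div_iff₀ hr0] at h3
    exact ⟨η', h2, by linarith⟩
  have hη'0 : 0 < η' := hη0.trans_lt hηη'
  set κ := r * (Real.log β + η') / Real.log β
  have hκ0 : 0 < κ := by positivity
  have hκ1 : κ < 1 := by rw [div_lt_one hL]; exact hη'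
  have hfreq : ∃ᶠ n : ℕ in atTop, φ n ≤ η' * n := by
    have h1 : lowerSlope φ < ENNReal.ofReal η' := by
      rw [← hη, ← ENNReal.ofReal_coe_nnreal, ENNReal.ofReal_lt_ofReal_iff hη'0]; exact hηη'
    refine ((frequently_lt_of_liminf_lt (by isBoundedDefault) h1).and_eventually
      (eventually_ge_atTop 1)).mono ?_
    rintro n ⟨hn, hn1⟩
    have hn0 : (0 : ℝ) < n := by exact_mod_cast hn1
    rw [ENNReal.ofReal_lt_ofReal_iff hη'0, div_lt_iff₀ hn0] at hn
    exact hn.le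
  -- The required exponent inequality reduces to κ ≤ θ², which holds for θ = (1 + κ)/2 because θ² -
  -- κ = ((1 - κ)/2)².
  obtain ⟨g, C, hC, hg, hgr⟩ := exists_expanding_map (θ := (1 + κ) / 2) (r := r) hβ hpos hmono htop
    hη'0 (by linarith) (by linarith) hfreq hr0 (by
      have e : (r : ℝ) = κ / (1 + η' / Real.log β) := by simp only [κ]; field_simp
      rw [← mul_div_assoc, e]
      gcongr
      nlinarith [sq_nonneg (1 - κ)])
  exact le_dimH_of_expanding (pos_iff_ne_zero.2 hr) hC hg hgr

theorem mainTheorem9 (β : ℝ) (hβ : 1 < β) (φ : ℕ → ℝ)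
    (hpos : ∀ n : ℕ, 1 ≤ n → 0 < φ n)
    (hmono : ∀ m n : ℕ, 1 ≤ m → m ≤ n → φ m ≤ φ n)
    (htop : Tendsto φ atTop atTop) :
    dimH (orbitLevelSet β φ) = 1 / (1 + lowerSlope φ / ENNReal.ofReal (Real.log β)) :=
  le_antisymm (dimH_orbitLevelSet_le hβ φ) (le_dimH_orbitLevelSet hβ hpos hmono htop)
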